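/- Let $X$ and $Y$ be Banach spaces over the same scalar field $\mathbb{K}\in\{\mathbb{R},\mathbb{C}\}$; an operator is a bounded linear map, and an isomorphism is a bijective operator. For $k\in\mathbb{Z}$ let $\Phi_k(X)$ be the set of Fredholm operators $T\colon X\to X$ (that is, $\dim\ker T<\infty$ and $\dim X/\operatorname{ran}T<\infty$) of index $\dim\ker T-\dim X/\operatorname{ran}T=k$, and put $\mathbb{I}_\Phi(X)=\{k\in\mathbb{Z}:\Phi_k(X)\neq\emptyset\}$; define $\Phi_k(Y)$ and $\mathbb{I}_\Phi(Y)$ in the same way. Operators $U\colon X\to X$ and $V\colon Y\to Y$ are *equivalent after extension* (EAE) if there are Banach spaces $X_0,Y_0$ over $\mathbb{K}$ and isomorphisms $E\colon Y\oplus Y_0\to X\oplus X_0$ and $F\colon X\oplus X_0\to Y\oplus Y_0$ such that $$\begin{bmatrix}U&0\\0&I_{X_0}\end{bmatrix}=E\begin{bmatrix}V&0\\0&I_{Y_0}\end{bmatrix}F,$$ and *Schur coupled* (SC) if there are isomorphisms $A\colon X\to X$, $D\colon Y\to Y$ and operators $B\colon Y\to X$, $C\colon X\to Y$ such that $U=A-BD^{-1}C$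 and $V=D-CA^{-1}B$. Let $\operatorname{EAE}_k(X,Y)$ and $\operatorname{SC}_k(X,Y)$ be the sets of pairs $(U,V)\in\Phi_k(X)\times\Phi_k(Y)$ that are EAE and SC, respectively, and put $\mathbb{I}_{\mathrm{SC}}(X,Y)=\{k\in\mathbb{Z}:\operatorname{SC}_k(X,Y)\neq\emptyset\}$. Let $\operatorname{eae}(X,Y)$ be the least integer $k\ge 1$ in $\mathbb{I}_\Phi(X)\cap\mathbb{I}_\Phi(Y)$, or $0$ if there is none, and let $\operatorname{sc}(X,Y)$ be the least integer $k\ge1$ in $\mathbb{I}_{\mathrm{SC}}(X,Y)$, or $0$ if there is none. Then: (i) $\operatorname{sc}(X,Y)=n\operatorname{eae}(X,Y)$ for some integer $n\ge 0$. (ii) $$\operatorname{sc}(X,Y)\mathbb{Z}\subseteq\mathbb{I}_{\mathrm{SC}}(X,Y)=\{k\in\mathbb{Z}:\operatorname{SC}_k(X,Y)=\operatorname{EAE}_k(X,Y)\neq\emptyset\}$$ $$\subseteq\operatorname{eae}(X,Y)\mathbb{Z}=\{k\in\mathbb{Z}:\operatorname{EAE}_k(X,Y)\neq\emptyset\}=\mathbb{I}_\Phi(X)\cap\mathbb{I}_\Phi(Y).$$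 (iii) $\operatorname{SC}_k(X,Y)=\operatorname{EAE}_k(X,Y)$ for every $k\in\mathbb{Z}$ if and only if $\operatorname{sc}(X,Y)=\operatorname{eae}(X,Y)$. -/

import Mathlib

universe u v

namespace FredholmPair

/-- For Banach spaces, Mathlib's Fredholm operators are precisely the bounded operators whose
kernel and cokernel are both finite-dimensional. -/
theorem isFredholm_iff {𝕜 : Type*} [RCLike 𝕜]
    {X : Type*} [NormedAddCommGroup X] [NormedSpace 𝕜 X] [CompleteSpace X]
    {Y : Type*} [NormedAddCommGroup Y] [NormedSpace 𝕜 Y] [CompleteSpace Y] (T : X →L[𝕜] Y) :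
    T.IsFredholm ↔ FiniteDimensional 𝕜 T.ker ∧ FiniteDimensional 𝕜 (Y ⧸ T.range) := by
  constructor
  · intro h
    exact ⟨h.finite_ker, h.finite_coker⟩
  · rintro ⟨hk, hc⟩
    have hkc : T.ker.ClosedComplemented := Submodule.ClosedComplemented.of_finiteDimensional _
    have hcl : IsClosed (T.range : Set Y) := by
      obtain ⟨X₁, hX₁, hcompl⟩ := hkc.exists_isClosed_isCompl
      have : CompleteSpace X₁ := hX₁.completeSpace_coe
      obtain ⟨G, hG⟩ := T.range.exists_isCompl
      have hGf : FiniteDimensional 𝕜 G :=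
        (Submodule.quotientEquivOfIsCompl _ G hG).finiteDimensional
      have hr : (T ∘L X₁.subtypeL).range = T.range := by
        apply le_antisymm
        · rintro _ ⟨x, rfl⟩
          exact ⟨x, rfl⟩
        · rintro _ ⟨x, rfl⟩
          have hx : x ∈ T.ker ⊔ X₁ := by rw [hcompl.sup_eq_top]; trivial
          obtain ⟨a, ha, b, hb, rfl⟩ := Submodule.mem_sup.1 hx
          refine ⟨⟨b, hb⟩, ?_⟩
          have ha' : T a = 0 := ha
          simp [ha']
      have hker : (T ∘L X₁.subtypeL).ker = ⊥ := by
        rw [eq_bot_iff]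
        intro x hx
        have h1 : (x : X) ∈ T.ker ⊓ X₁ := ⟨hx, x.2⟩
        rw [hcompl.inf_eq_bot] at h1
        simpa using h1
      rw [← hr]
      exact ContinuousLinearMap.closed_complemented_range_of_isCompl_of_ker_eq_bot _ G
        (hr ▸ hG) G.closed_of_finiteDimensional hker
    refine ⟨?_, hcl, hk, hc, hkc⟩
    have : CompleteSpace T.range := hcl.completeSpace_coe
    have hs : Function.Surjective T.rangeRestrict := fun ⟨y, x, hx⟩ => ⟨x, Subtype.ext hx⟩
    have ho := T.rangeRestrict.isOpenMap hs
    rw [Topology.isStrictMap_iff_isQuotientMap_rangeFactorization]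
    exact ho.isQuotientMap T.rangeRestrict.continuous hs

section Defs

variable {𝕜 : Type*} [RCLike 𝕜]
  {X : Type u} [NormedAddCommGroup X] [NormedSpace 𝕜 X]
  {Y : Type v} [NormedAddCommGroup Y] [NormedSpace 𝕜 Y]

/-- `U` and `V` are equivalent after extension: there are Banach spaces `X₀`, `Y₀` and isomorphisms
`E : Y ⊕ Y₀ → X ⊕ X₀`, `F : X ⊕ X₀ → Y ⊕ Y₀` with `U ⊕ I = E (V ⊕ I) F`. -/
def EquivAfterExt (U : X →L[𝕜] X) (V : Y →L[𝕜] Y) : Prop :=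
  ∃ (X₀ : Type (max u v)) (_ : NormedAddCommGroup X₀) (_ : NormedSpace 𝕜 X₀) (_ : CompleteSpace X₀)
    (Y₀ : Type (max u v)) (_ : NormedAddCommGroup Y₀) (_ : NormedSpace 𝕜 Y₀) (_ : CompleteSpace Y₀)
    (E : (Y × Y₀) ≃L[𝕜] (X × X₀)) (F : (X × X₀) ≃L[𝕜] (Y × Y₀)),
    U.prodMap (ContinuousLinearMap.id 𝕜 X₀) =
      (E : (Y × Y₀) →L[𝕜] (X × X₀)) ∘L V.prodMap (ContinuousLinearMap.id 𝕜 Y₀) ∘L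
        (F : (X × X₀) →L[𝕜] (Y × Y₀))

/-- `U` and `V` are Schur coupled: `U = A - B D⁻¹ C` and `V = D - C A⁻¹ B` for some operators
`B`, `C` and some isomorphisms `A`, `D`. -/
def SchurCoupled (U : X →L[𝕜] X) (V : Y →L[𝕜] Y) : Prop :=
  ∃ (A : X ≃L[𝕜] X) (B : Y →L[𝕜] X) (C : X →L[𝕜] Y) (D : Y ≃L[𝕜] Y),
    U = (A : X →L[𝕜] X) - B ∘L (D.symm : Y →L[𝕜] Y) ∘L C ∧
    V = (D : Y →L[𝕜] Y) - C ∘L (A.symm : X →L[𝕜] X) ∘L B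

variable (𝕜 X Y)

/-- `Φ_k(X)`: the Fredholm operators `T` on `X` of index `dim ker T - dim (X / ran T) = k`. -/
def Phi (k : ℤ) : Set (X →L[𝕜] X) :=
  {T | T.IsFredholm ∧
    (Module.finrank 𝕜 T.ker : ℤ) - (Module.finrank 𝕜 (X ⧸ T.range) : ℤ) = k}

/-- `EAE_k(X, Y)` -/
def EAE (k : ℤ) : Set ((X →L[𝕜] X) × (Y →L[𝕜] Y)) :=
  {p | p.1 ∈ Phi 𝕜 X k ∧ p.2 ∈ Phi 𝕜 Y k ∧ EquivAfterExt p.1 p.2}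

/-- `SC_k(X, Y)` -/
def SC (k : ℤ) : Set ((X →L[𝕜] X) × (Y →L[𝕜] Y)) :=
  {p | p.1 ∈ Phi 𝕜 X k ∧ p.2 ∈ Phi 𝕜 Y k ∧ SchurCoupled p.1 p.2}

/-- `I_Φ(X)`: the integers `k` for which `Φ_k(X)` is non-empty. -/
def IPhi : Set ℤ := {k | (Phi 𝕜 X k).Nonempty}

/-- `I_SC(X, Y)`: the integers `k` for which `SC_k(X, Y)` is non-empty. -/
def ISC : Set ℤ := {k | (SC 𝕜 X Y k).Nonempty}

/-- `eae(X, Y)`: the least `k ≥ 1` in `I_Φ(X) ∩ I_Φ(Y)`, or `0` if there is none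
(the infimum of the empty set of natural numbers is `0`). -/
noncomputable def eae : ℕ := sInf {k : ℕ | 1 ≤ k ∧ (k : ℤ) ∈ IPhi 𝕜 X ∩ IPhi 𝕜 Y}

/-- `sc(X, Y)`: the least `k ≥ 1` in `I_SC(X, Y)`, or `0` if there is none. -/
noncomputable def sc : ℕ := sInf {k : ℕ | 1 ≤ k ∧ (k : ℤ) ∈ ISC 𝕜 X Y}

end Defs

/-- `nℤ` -/
def multiples (n : ℕ) : Set ℤ := {k | ∃ m : ℤ, k = n * m}

end FredholmPair

/-! Everything is reduced to the pair (a, b) of dimensions of kernel and cokernel. Two Fredholm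
operators, on X and on Y, are EAE exactly when they have the same (a, b) (`EquivAfterExt.hasDefect`,
`HasDefect.equivAfterExt`). Schur coupling means, up to isomorphisms, being 1 - BC and 1 - CB; these
always have equal defects, so SC pairs are EAE. Conversely, operators with defects (a, b) are SC as
soon as some 1 - BC factoring through Y has these defects, i.e. `Pairable` holds
(`Pairable.schurCoupled`).

Only the index matters for `Pairable`: rank-one changes of B lower or raise both defects by one
(`Pairable.of_succ`, `Pairable.succ`), and index 0 is treated by projections (`pairable_self`).
Hence one SC pair of index k makes every EAE pair of index k Schur coupled (`SC_eq_EAE`).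

The index sets of X and Y are subgroups of ℤ, which gives the statements on eae. For sc there is
only closure under integer multiples (`Pairable.exists_index_mul`): for fixed B the operators 1 - BC
are closed under products and have quasi-inverses of the same form, but different B cannot be
combined in this way. -/

namespace FredholmPair

/-! ### Kernel and cokernel dimensions of linear maps -/

section Defect

open Module

variable {k : Type*} [Field k]
  {M : Type*} [AddCommGroup M] [Module k M] {N : Type*} [AddCommGroup N] [Module k N]
  {P : Type*} [AddCommGroup P] [Module k P] {Q : Type*} [AddCommGroup Q] [Module k Q]

/-- The kernel and the cokernel of `f` have the finite dimensions `a` and `b`. -/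
structure HasDefect (f : M →ₗ[k] N) (a b : ℕ) : Prop where
  finite_ker : FiniteDimensional k f.ker
  finite_coker : FiniteDimensional k (N ⧸ f.range)
  finrank_ker : finrank k f.ker = a
  finrank_coker : finrank k (N ⧸ f.range) = b

theorem HasDefect.index {f : M →ₗ[k] N} {a b : ℕ} (h : HasDefect f a b) :
    f.index = (a : ℤ) - b := by
  rw [LinearMap.index_eq_finrank_sub, h.finrank_ker, h.finrank_coker]

theorem HasDefect.congr {f : M →ₗ[k] N} {g : P →ₗ[k] Q} {a b : ℕ} (h : HasDefect f a b)
    (e₁ : f.ker ≃ₗ[k] g.ker) (e₂ : (N ⧸ f.range) ≃ₗ[k] Q ⧸ g.range) : HasDefect g a b := by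
  obtain ⟨h₁, h₂, h₃, h₄⟩ := h
  exact ⟨e₁.finiteDimensional, e₂.finiteDimensional, e₁.finrank_eq ▸ h₃, e₂.finrank_eq ▸ h₄⟩

/-- The kernels and cokernels of `1 - BC` and `1 - CB` are isomorphic. -/
theorem HasDefect.swap {B : N →ₗ[k] M} {C : M →ₗ[k] N} {a b : ℕ}
    (h : HasDefect (LinearMap.id - B ∘ₗ C) a b) : HasDefect (LinearMap.id - C ∘ₗ B) a b := by
  -- `C` and `B` induce mutually inverse maps on kernels and on cokernels, because C(1 - BC) = (1 -
  -- CB)C and BC is the identity on ker(1 - BC) and modulo ran(1 - BC).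
  refine h.congr (LinearEquiv.ofLinearMap
    (C.restrict fun x hx => ?_) (B.restrict fun y hy => ?_) ?_ ?_)
    (LinearEquiv.ofLinearMap (Submodule.mapQ _ _ C ?_) (Submodule.mapQ _ _ B ?_) ?_ ?_)
  · simp only [LinearMap.mem_ker, LinearMap.sub_apply, LinearMap.id_apply,
      LinearMap.comp_apply] at hx ⊢
    rw [← map_sub, hx, map_zero]
  · simp only [LinearMap.mem_ker, LinearMap.sub_apply, LinearMap.id_apply,
      LinearMap.comp_apply] at hy ⊢
    rw [← map_sub, hy, map_zero]
  · ext ⟨y, hy⟩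
    simp only [LinearMap.mem_ker, LinearMap.sub_apply, LinearMap.id_apply,
      LinearMap.comp_apply] at hy
    simpa [LinearMap.restrict_apply] using (sub_eq_zero.1 hy).symm
  · ext ⟨y, hy⟩
    simp only [LinearMap.mem_ker, LinearMap.sub_apply, LinearMap.id_apply,
      LinearMap.comp_apply] at hy
    simpa [LinearMap.restrict_apply] using (sub_eq_zero.1 hy).symm
  · rintro _ ⟨x, rfl⟩
    exact ⟨C x, by simp⟩
  · rintro _ ⟨x, rfl⟩
    exact ⟨B x, by simp⟩
  · ext y
    simp only [LinearMap.comp_apply, Submodule.mkQ_apply, Submodule.mapQ_apply, LinearMap.id_apply]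
    rw [Submodule.Quotient.eq]
    exact ⟨-y, by simp; abel⟩
  · ext y
    simp only [LinearMap.comp_apply, Submodule.mkQ_apply, Submodule.mapQ_apply, LinearMap.id_apply]
    rw [Submodule.Quotient.eq]
    exact ⟨-y, by simp; abel⟩

theorem HasDefect.equiv_comp {f : N →ₗ[k] P} {a b : ℕ} (h : HasDefect f a b)
    (e : P ≃ₗ[k] Q) (g : M ≃ₗ[k] N) :
    HasDefect ((e : P →ₗ[k] Q) ∘ₗ f ∘ₗ (g : M →ₗ[k] N)) a b := by
  refine h.congr (LinearEquiv.ofBijective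
    ((g.symm : N →ₗ[k] M).restrict fun x hx => ?_) ⟨?_, ?_⟩) (Submodule.Quotient.equiv _ _ e ?_)
  · simpa using hx
  · intro x y hxy
    have := congrArg Subtype.val hxy
    exact Subtype.ext (g.symm.injective this)
  · rintro ⟨x, hx⟩
    have hx' : f (g x) = 0 := by simpa using hx
    exact ⟨⟨g x, hx'⟩, Subtype.ext (g.symm_apply_apply x)⟩
  · rw [LinearMap.range_comp, LinearMap.range_comp, LinearEquiv.range, Submodule.map_top]

theorem exists_hasDefect (f : M →ₗ[k] N) [h₁ : FiniteDimensional k f.ker]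
    [h₂ : FiniteDimensional k (N ⧸ f.range)] : ∃ a b, HasDefect f a b :=
  ⟨_, _, h₁, h₂, rfl, rfl⟩

theorem HasDefect.comp {f : M →ₗ[k] N} {g : N →ₗ[k] P} {a b c d : ℕ}
    (hf : HasDefect f a b) (hg : HasDefect g c d) :
    ∃ p q : ℕ, HasDefect (g ∘ₗ f) p q ∧ (p : ℤ) - q = (a - b) + (c - d) := by
  have := hf.finite_ker
  have := hf.finite_coker
  have := hg.finite_ker
  have := hg.finite_coker
  have : FiniteDimensional k (g ∘ₗ f).ker := by rw [LinearMap.ker_comp]; infer_instance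
  have : FiniteDimensional k (P ⧸ (g ∘ₗ f).range) := by rw [LinearMap.range_comp]; infer_instance
  obtain ⟨p, q, h⟩ := exists_hasDefect (g ∘ₗ f)
  refine ⟨p, q, h, ?_⟩
  rw [← h.index, ← hf.index, ← hg.index, LinearMap.index_comp, add_comm]

/-- Perturbations of the identity that factor through a finite-dimensional space have index `0`. -/
theorem exists_hasDefect_id_sub [FiniteDimensional k N] (B : N →ₗ[k] M) (C : M →ₗ[k] N) :
    ∃ a, HasDefect (LinearMap.id - B ∘ₗ C) a a := by
  -- 1 - CB acts on the finite-dimensional `N`, where every endomorphism has index 0; swapping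
  -- carries this over to `M`.
  obtain ⟨a, b, h⟩ := exists_hasDefect (LinearMap.id - C ∘ₗ B)
  have h' := h.index
  rw [LinearMap.index_eq_of_finiteDimensional] at h'
  obtain rfl : a = b := by lia
  exact ⟨a, h.swap⟩

theorem exists_hasDefect_id_sub_of_finite_range (F : M →ₗ[k] M) [FiniteDimensional k F.range] :
    ∃ a, HasDefect (LinearMap.id - F) a a :=
  exists_hasDefect_id_sub F.range.subtype F.rangeRestrict

theorem hasDefect_id : HasDefect (LinearMap.id : M →ₗ[k] M) 0 0 := by
  have : Subsingleton (M ⧸ (LinearMap.id : M →ₗ[k] M).range) := by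
    rw [Submodule.Quotient.subsingleton_iff, LinearMap.range_id]
  have : Subsingleton (LinearMap.id : M →ₗ[k] M).ker := by
    rw [LinearMap.ker_id]
    infer_instance
  exact ⟨inferInstance, inferInstance, finrank_zero_of_subsingleton, finrank_zero_of_subsingleton⟩

/-- If `p ∘ i = 1` on a space of dimension `n`, then `1 - i ∘ p` has defects `n` and `n`. -/
theorem hasDefect_id_sub_of_comp_eq_id [FiniteDimensional k N] {i : N →ₗ[k] M} {p : M →ₗ[k] N}
    (h : p ∘ₗ i = LinearMap.id) :
    HasDefect (LinearMap.id - i ∘ₗ p) (finrank k N) (finrank k N) := by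
  refine HasDefect.swap ?_
  rw [h, sub_self]
  refine ⟨inferInstance, inferInstance, ?_, ?_⟩
  · rw [LinearMap.ker_zero, finrank_top]
  · rw [LinearMap.range_zero]
    exact (Submodule.quotEquivOfEqBot _ rfl).finrank_eq

theorem exists_hasDefect_id_sub_smulRight (z : M) (ψ : M →ₗ[k] k) :
    ∃ a, HasDefect (LinearMap.id - ψ.smulRight z) a a := by
  convert exists_hasDefect_id_sub (LinearMap.toSpanSingleton k M z) ψ
  ext
  simp

/-- As `x` is outside ran f, the kernel shrinks to ker f ∩ ker ψ, which loses exactly the line of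
`v`. The cokernel then follows from the index, since f = g(1 - ψ ⊗ v) and the second factor has
index 0. -/
theorem HasDefect.add_smulRight {f : M →ₗ[k] N} {a b : ℕ} (h : HasDefect f (a + 1) (b + 1))
    {ψ : M →ₗ[k] k} {v : M} (hv : f v = 0) (hψ : ψ v = 1) {x : N} (hx : x ∉ f.range) :
    HasDefect (f + ψ.smulRight x) a b := by
  set g := f + ψ.smulRight x with hg
  have hfin₁ := h.finite_ker
  have hfin₂ := h.finite_coker
  have hgv : g v = x := by simp [hg, hv, hψ]
  have hf : g ∘ₗ (LinearMap.id - ψ.smulRight v) = f := by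
    ext w
    simp [hg, hv, hψ]
  have hker : ∀ w, g w = 0 → f w = 0 ∧ ψ w = 0 := by
    intro w hw
    have hψw : ψ w = 0 := by
      by_contra hne
      refine hx ⟨-((ψ w)⁻¹ • w), ?_⟩
      have : f w = -(ψ w • x) := by simpa [hg, add_eq_zero_iff_eq_neg] using hw
      simp [this, smul_smul, hne]
    exact ⟨by simpa [hg, hψw] using hw, hψw⟩
  have hle : g.ker ≤ f.ker := fun w hw => (hker w hw).1
  have hrange : f.range ≤ g.range := by
    rw [← hf]
    exact LinearMap.range_comp_le_range _ _
  have : FiniteDimensional k g.ker := Submodule.finiteDimensional_of_le hle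
  have : FiniteDimensional k (N ⧸ g.range) :=
    Module.Finite.of_surjective _ (Submodule.factor_surjective hrange)
  obtain ⟨c, d, hcd⟩ := exists_hasDefect g
  obtain ⟨m, hm⟩ := exists_hasDefect_id_sub_smulRight v ψ
  obtain ⟨p, q, hpq, hpq'⟩ := hm.comp hcd
  rw [hf] at hpq
  have h1 := hpq.index
  rw [h.index] at h1
  have e : f.ker ≃ₗ[k] g.ker × k := LinearEquiv.ofLinearMap
    (LinearMap.prod ((LinearMap.id - ψ.smulRight v).restrict fun w hw => by
      have hw : f w = 0 := hw
      simp [hg, hw, hv, hψ]) (ψ ∘ₗ f.ker.subtype))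
    (LinearMap.coprod (Submodule.inclusion hle) (LinearMap.toSpanSingleton k f.ker ⟨v, hv⟩))
    (by
      ext w
      · simp [LinearMap.restrict_apply, (hker w w.2).2]
      · simp [(hker w w.2).2]
      · simp [LinearMap.restrict_apply, hψ]
      · simp [hψ])
    (by ext w; simp [LinearMap.restrict_apply])
  have := e.finrank_eq
  rw [finrank_prod, finrank_self, h.finrank_ker, hcd.finrank_ker] at this
  obtain rfl : c = a := by lia
  obtain rfl : d = b := by push_cast at h1; lia
  exact hcd

/-- The new map is f(1 - ψ ⊗ z): its index is unchanged, and its kernel is ker f plus the line of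
`z`. -/
theorem HasDefect.sub_smulRight {f : M →ₗ[k] N} {a b : ℕ} (h : HasDefect f a b)
    {ψ : M →ₗ[k] k} (hψ : ∀ w, f w = 0 → ψ w = 0) {z : M} (hz : ψ z = 1) :
    HasDefect (f - ψ.smulRight (f z)) (a + 1) (b + 1) := by
  have hf : f - ψ.smulRight (f z) = f ∘ₗ (LinearMap.id - ψ.smulRight z) := by
    ext w
    simp
  obtain ⟨m, hm⟩ := exists_hasDefect_id_sub_smulRight z ψ
  obtain ⟨p, q, hpq, hpq'⟩ := hm.comp h
  rw [hf]
  set g := f ∘ₗ (LinearMap.id - ψ.smulRight z) with hg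
  have hle : f.ker ≤ g.ker := fun w hw => by
    have hw : f w = 0 := hw
    simp [hg, hψ w hw, hw]
  have hgz : g z = 0 := by simp [hg, hz]
  have e : g.ker ≃ₗ[k] f.ker × k := LinearEquiv.ofLinearMap
    (LinearMap.prod ((LinearMap.id - ψ.smulRight z).restrict fun w hw => by
      have hw : f (w - ψ w • z) = 0 := hw
      simpa using hw) (ψ ∘ₗ g.ker.subtype))
    (LinearMap.coprod (Submodule.inclusion hle) (LinearMap.toSpanSingleton k g.ker ⟨z, hgz⟩))
    (by
      ext w
      · simp [LinearMap.restrict_apply, hψ w w.2]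
      · simp [hψ w w.2]
      · simp [LinearMap.restrict_apply, hz]
      · simp [hz])
    (by ext w; simp [LinearMap.restrict_apply])
  have := h.finite_ker
  have := e.finrank_eq
  rw [finrank_prod, finrank_self, h.finrank_ker, hpq.finrank_ker] at this
  obtain rfl : p = a + 1 := this
  obtain rfl : q = b + 1 := by push_cast at hpq'; lia
  exact hpq

/-- A map that is inverse to a Fredholm map up to Fredholm maps of index `0` is Fredholm of the
opposite index. -/
theorem HasDefect.of_comp_comp {f : M →ₗ[k] N} {g : N →ₗ[k] M} {a b c d : ℕ}
    (h : HasDefect f a b) (hgf : HasDefect (g ∘ₗ f) c c) (hfg : HasDefect (f ∘ₗ g) d d) :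
    ∃ p q : ℕ, HasDefect g p q ∧ (p : ℤ) - q = b - a := by
  have := hgf.finite_coker
  have := hfg.finite_ker
  have : FiniteDimensional k g.ker :=
    Submodule.finiteDimensional_of_le (LinearMap.ker_le_ker_comp g f)
  have : FiniteDimensional k (M ⧸ g.range) :=
    Module.Finite.of_surjective _ (Submodule.factor_surjective (LinearMap.range_comp_le_range f g))
  obtain ⟨p, q, hg⟩ := exists_hasDefect g
  obtain ⟨r, s, hrs, hrs'⟩ := h.comp hg
  have := hrs.index
  rw [hgf.index] at this
  exact ⟨p, q, hg, by lia⟩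

end Defect

end FredholmPair

/-! ### Normal forms and quasi-inverses of Fredholm operators -/

namespace FredholmPair

section Banach

open Module

variable {𝕜 : Type*} [RCLike 𝕜]
  {X : Type*} [NormedAddCommGroup X] [NormedSpace 𝕜 X] [CompleteSpace X]
  {Y : Type*} [NormedAddCommGroup Y] [NormedSpace 𝕜 Y] [CompleteSpace Y]
  {X' : Type*} [NormedAddCommGroup X'] [NormedSpace 𝕜 X'] [CompleteSpace X']
  {Y' : Type*} [NormedAddCommGroup Y'] [NormedSpace 𝕜 Y'] [CompleteSpace Y']

theorem HasDefect.isFredholm {T : X →L[𝕜] Y} {a b : ℕ} (h : HasDefect T.toLinearMap a b) :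
    T.IsFredholm :=
  (isFredholm_iff T).2 ⟨h.finite_ker, h.finite_coker⟩

theorem mem_Phi_iff {T : X →L[𝕜] X} {k : ℤ} :
    T ∈ Phi 𝕜 X k ↔ ∃ a b : ℕ, HasDefect T.toLinearMap a b ∧ (a : ℤ) - b = k := by
  constructor
  · rintro ⟨h, hk⟩
    exact ⟨_, _, ⟨h.finite_ker, h.finite_coker, rfl, rfl⟩, hk⟩
  · rintro ⟨a, b, h, hk⟩
    exact ⟨h.isFredholm, by rw [h.finrank_ker, h.finrank_coker, hk]⟩

/-- A Fredholm operator is, up to isomorphisms of its domain and codomain, the projection of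
`Z ⊕ K` onto `Z` followed by the inclusion into `Z ⊕ L`, with `K`, `L` finite-dimensional. -/
theorem HasDefect.exists_normal_form {T : X →L[𝕜] Y} {a b : ℕ}
    (h : HasDefect T.toLinearMap a b) :
    ∃ (Z : Submodule 𝕜 X) (_ : CompleteSpace Z)
      (e : X ≃L[𝕜] Z × (Fin a → 𝕜)) (f : Y ≃L[𝕜] Z × (Fin b → 𝕜)),
      ∀ x, T x = f.symm ((e x).1, 0) := by
  obtain ⟨p⟩ := h.isFredholm.nonempty_fredholmPackage
  have := p.decDom.finite_X₀
  have := p.decCodom.finite_X₀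
  have hZ : CompleteSpace p.decDom.X₁ :=
    (p.decDom.isTopCompl.symm.isClosed').completeSpace_coe
  have h₁ : finrank 𝕜 p.decDom.X₀ = finrank 𝕜 (Fin a → 𝕜) := by
    rw [finrank_fin_fun, ← h.finrank_ker, p.ker_eq]
  have h₂ : finrank 𝕜 p.decCodom.X₀ = finrank 𝕜 (Fin b → 𝕜) := by
    rw [finrank_fin_fun, ← h.finrank_coker, p.range_eq]
    exact (Submodule.quotientEquivOfIsCompl _ _ p.decCodom.isTopCompl.isCompl).finrank_eq.symm
  refine ⟨p.decDom.X₁, hZ,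
    (Submodule.prodEquivOfIsTopCompl _ _ p.decDom.isTopCompl).symm.trans
      ((ContinuousLinearEquiv.refl 𝕜 _).prodCongr (ContinuousLinearEquiv.ofFinrankEq h₁)),
    (Submodule.prodEquivOfIsTopCompl _ _ p.decCodom.isTopCompl).symm.trans
      (p.equiv.symm.prodCongr (ContinuousLinearEquiv.ofFinrankEq h₂)), fun x => ?_⟩
  have := congrArg (fun S : X →L[𝕜] Y => S x) p.eq_equiv
  rw [this]
  simp [Submodule.prodEquivOfIsCompl_symm_apply]

/-- Banach spaces connected by an operator with kernel and cokernel of the same finite dimension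
are isomorphic. -/
theorem HasDefect.nonempty_equiv {T : X →L[𝕜] Y} {a : ℕ} (h : HasDefect T.toLinearMap a a) :
    Nonempty (X ≃L[𝕜] Y) := by
  obtain ⟨Z, _, e, f, -⟩ := h.exists_normal_form
  exact ⟨e.trans f.symm⟩

theorem hasDefect_fst {Z : Type*} [NormedAddCommGroup Z] [NormedSpace 𝕜 Z] (n : ℕ) :
    HasDefect (ContinuousLinearMap.fst 𝕜 Z (Fin n → 𝕜)).toLinearMap n 0 := by
  change HasDefect (LinearMap.fst 𝕜 Z (Fin n → 𝕜)) n 0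
  have e : (Fin n → 𝕜) ≃ₗ[𝕜] (LinearMap.fst 𝕜 Z (Fin n → 𝕜)).ker :=
    (LinearEquiv.ofInjective _ LinearMap.inr_injective).trans
      (LinearEquiv.ofEq _ _ (LinearMap.ker_fst _ _ _).symm)
  have : Subsingleton (Z ⧸ (LinearMap.fst 𝕜 Z (Fin n → 𝕜)).range) := by
    rw [Submodule.Quotient.subsingleton_iff, LinearMap.range_eq_top.2 LinearMap.fst_surjective]
  exact ⟨e.finiteDimensional, inferInstance,
    e.finrank_eq.symm.trans (finrank_fin_fun 𝕜), finrank_zero_of_subsingleton⟩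

theorem hasDefect_inl {Z : Type*} [NormedAddCommGroup Z] [NormedSpace 𝕜 Z] (n : ℕ) :
    HasDefect (ContinuousLinearMap.inl 𝕜 Z (Fin n → 𝕜)).toLinearMap 0 n := by
  change HasDefect (LinearMap.inl 𝕜 Z (Fin n → 𝕜)) 0 n
  have e : ((Z × (Fin n → 𝕜)) ⧸ (LinearMap.inl 𝕜 Z (Fin n → 𝕜)).range) ≃ₗ[𝕜] (Fin n → 𝕜) :=
    (Submodule.quotEquivOfEq _ _ (LinearMap.range_inl _ _ _)).trans
      (LinearMap.quotKerEquivOfSurjective _ LinearMap.snd_surjective)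
  have : Subsingleton (LinearMap.inl 𝕜 Z (Fin n → 𝕜)).ker := by
    rw [LinearMap.ker_eq_bot.2 LinearMap.inl_injective]
    infer_instance
  exact ⟨inferInstance, e.symm.finiteDimensional, finrank_zero_of_subsingleton,
    e.finrank_eq.trans (finrank_fin_fun 𝕜)⟩

/-- Isomorphic finite-dimensional summands can be cancelled. -/
theorem nonempty_equiv_of_prod (n : ℕ) (e : (X × (Fin n → 𝕜)) ≃L[𝕜] (Y × (Fin n → 𝕜))) :
    Nonempty (X ≃L[𝕜] Y) := by
  have h₁ := ((hasDefect_inl (𝕜 := 𝕜) (Z := X) n).equiv_comp e.toLinearEquiv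
    (LinearEquiv.refl 𝕜 X))
  -- The composite X → X × 𝕜ⁿ → Y × 𝕜ⁿ → Y has index -n + n = 0.
  obtain ⟨a, b, h, hab⟩ := h₁.comp (hasDefect_fst (𝕜 := 𝕜) (Z := Y) n)
  obtain rfl : a = b := by lia
  exact HasDefect.nonempty_equiv
    (T := ContinuousLinearMap.fst 𝕜 Y (Fin n → 𝕜) ∘L
    (e : (X × (Fin n → 𝕜)) →L[𝕜] (Y × (Fin n → 𝕜))) ∘L ContinuousLinearMap.inl 𝕜 X (Fin n → 𝕜)) h

/-- Fredholm operators with kernels and cokernels of the same dimensions are equivalent. -/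
theorem HasDefect.exists_equiv {T : X →L[𝕜] Y} {S : X' →L[𝕜] Y'} {a b : ℕ}
    (hT : HasDefect T.toLinearMap a b) (hS : HasDefect S.toLinearMap a b) (e : X ≃L[𝕜] X') :
    ∃ (E : Y' ≃L[𝕜] Y) (F : X ≃L[𝕜] X'),
      T = (E : Y' →L[𝕜] Y) ∘L S ∘L (F : X →L[𝕜] X') := by
  obtain ⟨Z, _, e₁, f₁, h₁⟩ := hT.exists_normal_form
  obtain ⟨Z', _, e₂, f₂, h₂⟩ := hS.exists_normal_form
  -- An isomorphism of the domains suffices: cancelling the kernels identifies `Z` with `Z'`, and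
  -- hence also the codomains.
  obtain ⟨c⟩ := nonempty_equiv_of_prod a (e₁.symm.trans (e.trans e₂))
  refine ⟨f₂.trans ((c.symm.prodCongr (.refl 𝕜 _)).trans f₁.symm),
    e₁.trans ((c.prodCongr (.refl 𝕜 _)).trans e₂.symm), ?_⟩
  ext x
  simp [h₁, h₂]

/-- A quasi-inverse: both products with `T` differ from the identity by finite-rank operators. -/
theorem HasDefect.exists_quasiInverse {T : X →L[𝕜] Y} {a b : ℕ} (h : HasDefect T.toLinearMap a b) :
    ∃ S : Y →L[𝕜] X,
      FiniteDimensional 𝕜 (ContinuousLinearMap.id 𝕜 X - S ∘L T).range ∧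
      FiniteDimensional 𝕜 (ContinuousLinearMap.id 𝕜 Y - T ∘L S).range := by
  obtain ⟨Z, _, e, f, hT⟩ := h.exists_normal_form
  refine ⟨(e.symm : _ →L[𝕜] X) ∘L ContinuousLinearMap.inl 𝕜 Z (Fin a → 𝕜) ∘L
    ContinuousLinearMap.fst 𝕜 Z (Fin b → 𝕜) ∘L (f : Y →L[𝕜] _), ?_, ?_⟩
  · refine Submodule.finiteDimensional_of_le
      (S₂ := (e.symm.toLinearMap ∘ₗ LinearMap.inr 𝕜 Z (Fin a → 𝕜)).range) ?_
    rintro _ ⟨x, rfl⟩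
    exact ⟨(e x).2, e.injective (by simp [hT, Prod.ext_iff])⟩
  · refine Submodule.finiteDimensional_of_le
      (S₂ := (f.symm.toLinearMap ∘ₗ LinearMap.inr 𝕜 Z (Fin b → 𝕜)).range) ?_
    rintro _ ⟨x, rfl⟩
    exact ⟨(f x).2, f.injective (by simp [hT, Prod.ext_iff])⟩

end Banach
end FredholmPair

/-! ### Equivalence after extension, Schur coupling and pairable defects -/

namespace FredholmPair

section Pairs

open Module

variable {𝕜 : Type*} [RCLike 𝕜]
  {X : Type u} [NormedAddCommGroup X] [NormedSpace 𝕜 X]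
  {Y : Type v} [NormedAddCommGroup Y] [NormedSpace 𝕜 Y]

/-- U ⊕ 1 and U are 1 - ip and 1 - pi, where i is the inclusion of X and p is 1 - U after the
projection. -/
theorem hasDefect_prodMap_id_iff {Z : Type*} [NormedAddCommGroup Z] [NormedSpace 𝕜 Z]
    {U : X →L[𝕜] X} {a b : ℕ} :
    HasDefect (U.prodMap (ContinuousLinearMap.id 𝕜 Z)).toLinearMap a b ↔
      HasDefect U.toLinearMap a b := by
  have h₁ : (LinearMap.id : X × Z →ₗ[𝕜] X × Z) - LinearMap.inl 𝕜 X Z ∘ₗ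
      ((LinearMap.id - U.toLinearMap) ∘ₗ LinearMap.fst 𝕜 X Z) =
      (U.prodMap (ContinuousLinearMap.id 𝕜 Z)).toLinearMap := by
    ext <;> simp
  have h₂ : LinearMap.id - ((LinearMap.id - U.toLinearMap) ∘ₗ LinearMap.fst 𝕜 X Z) ∘ₗ
      LinearMap.inl 𝕜 X Z = U.toLinearMap := by
    ext
    simp
  rw [← h₁]
  nth_rw 2 [← h₂]
  exact ⟨HasDefect.swap, HasDefect.swap⟩

theorem HasDefect.equiv_comp_iff {X' Y' : Type*} [NormedAddCommGroup X'] [NormedSpace 𝕜 X']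
    [NormedAddCommGroup Y'] [NormedSpace 𝕜 Y'] {S : X' →L[𝕜] Y'} (E : Y' ≃L[𝕜] Y)
    (F : X ≃L[𝕜] X') {a b : ℕ} :
    HasDefect ((E : Y' →L[𝕜] Y) ∘L S ∘L (F : X →L[𝕜] X')).toLinearMap a b ↔
      HasDefect S.toLinearMap a b := by
  refine ⟨fun h => ?_, fun h => h.equiv_comp E.toLinearEquiv F.toLinearEquiv⟩
  convert h.equiv_comp E.symm.toLinearEquiv F.symm.toLinearEquiv
  ext
  simp

/-- Equivalence after extension preserves the dimensions of kernel and cokernel. -/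
theorem EquivAfterExt.hasDefect {U : X →L[𝕜] X} {V : Y →L[𝕜] Y} (h : EquivAfterExt U V)
    {a b : ℕ} (hU : HasDefect U.toLinearMap a b) : HasDefect V.toLinearMap a b := by
  obtain ⟨X₀, _, _, _, Y₀, _, _, _, E, F, h⟩ := h
  rw [← hasDefect_prodMap_id_iff (Z := X₀), h, HasDefect.equiv_comp_iff,
    hasDefect_prodMap_id_iff] at hU
  exact hU

theorem HasDefect.equivAfterExt [CompleteSpace X] [CompleteSpace Y]
    {U : X →L[𝕜] X} {V : Y →L[𝕜] Y} {a b : ℕ} (hU : HasDefect U.toLinearMap a b)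
    (hV : HasDefect V.toLinearMap a b) : EquivAfterExt U V := by
  -- Extending `U` by Y and `V` by X makes the domains isomorphic by the flip X × Y ≅ Y × X; the
  -- lifts only adjust universes.
  obtain ⟨E, F, h⟩ := ((hasDefect_prodMap_id_iff (Z := ULift.{max u v} Y)).2 hU).exists_equiv
    ((hasDefect_prodMap_id_iff (Z := ULift.{max u v} X)).2 hV)
    (((ContinuousLinearEquiv.refl 𝕜 X).prodCongr ContinuousLinearEquiv.ulift).trans
      ((ContinuousLinearEquiv.prodComm 𝕜 X Y).trans
        ((ContinuousLinearEquiv.refl 𝕜 Y).prodCongr ContinuousLinearEquiv.ulift.symm)))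
  exact ⟨_, _, _, inferInstance, _, _, _, inferInstance, E, F, h⟩

/-- Schur coupled operators are, up to isomorphisms, of the form `1 - BC` and `1 - CB`. -/
theorem schurCoupled_iff {U : X →L[𝕜] X} {V : Y →L[𝕜] Y} :
    SchurCoupled U V ↔ ∃ (E F : X ≃L[𝕜] X) (E' F' : Y ≃L[𝕜] Y) (B : Y →L[𝕜] X) (C : X →L[𝕜] Y),
      U = (E : X →L[𝕜] X) ∘L (ContinuousLinearMap.id 𝕜 X - B ∘L C) ∘L (F : X →L[𝕜] X) ∧
      V = (E' : Y →L[𝕜] Y) ∘L (ContinuousLinearMap.id 𝕜 Y - C ∘L B) ∘L (F' : Y →L[𝕜] Y) := by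
  constructor
  · rintro ⟨A, B, C, D, rfl, rfl⟩
    refine ⟨.refl 𝕜 X, A, .refl 𝕜 Y, D, B ∘L (D.symm : Y →L[𝕜] Y), C ∘L (A.symm : X →L[𝕜] X),
      ?_, ?_⟩ <;> ext <;> simp
  · rintro ⟨E, F, E', F', B, C, rfl, rfl⟩
    refine ⟨F.trans E, (E : X →L[𝕜] X) ∘L B ∘L (F' : Y →L[𝕜] Y),
      (E' : Y →L[𝕜] Y) ∘L C ∘L (F : X →L[𝕜] X), F'.trans E', ?_, ?_⟩ <;> ext <;> simp

variable (𝕜 X Y) in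
/-- The defects `(a, b)` that occur for some operator `1 - BC` that factors through `Y`. -/
def Pairable (a b : ℕ) : Prop :=
  ∃ (B : Y →L[𝕜] X) (C : X →L[𝕜] Y),
    HasDefect (ContinuousLinearMap.id 𝕜 X - B ∘L C).toLinearMap a b

theorem SchurCoupled.hasDefect {U : X →L[𝕜] X} {V : Y →L[𝕜] Y} (h : SchurCoupled U V)
    {a b : ℕ} (hU : HasDefect U.toLinearMap a b) :
    HasDefect V.toLinearMap a b ∧ Pairable 𝕜 X Y a b := by
  obtain ⟨E, F, E', F', B, C, rfl, rfl⟩ := schurCoupled_iff.1 h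
  rw [HasDefect.equiv_comp_iff] at hU ⊢
  exact ⟨HasDefect.swap (B := B.toLinearMap) (C := C.toLinearMap) hU, B, C, hU⟩

theorem Pairable.schurCoupled [CompleteSpace X] [CompleteSpace Y] {a b : ℕ}
    (h : Pairable 𝕜 X Y a b) {U : X →L[𝕜] X} {V : Y →L[𝕜] Y}
    (hU : HasDefect U.toLinearMap a b) (hV : HasDefect V.toLinearMap a b) : SchurCoupled U V := by
  obtain ⟨B, C, h⟩ := h
  have h' : HasDefect (ContinuousLinearMap.id 𝕜 Y - C ∘L B).toLinearMap a b :=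
    HasDefect.swap (B := B.toLinearMap) (C := C.toLinearMap) h
  obtain ⟨E, F, rfl⟩ := hU.exists_equiv h (.refl 𝕜 X)
  obtain ⟨E', F', rfl⟩ := hV.exists_equiv h' (.refl 𝕜 Y)
  exact schurCoupled_iff.2 ⟨E, F, E', F', B, C, rfl, rfl⟩

/-- A nonzero `v` in the kernel satisfies v = BCv, so Cv ≠ 0 and the functional needed in
`HasDefect.add_smulRight` can be taken of the form φ ∘ C. The rank-one term is then absorbed into
`B`. -/
theorem Pairable.of_succ {a b : ℕ} (h : Pairable 𝕜 X Y (a + 1) (b + 1)) : Pairable 𝕜 X Y a b := by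
  obtain ⟨B, C, h⟩ := h
  obtain ⟨v, hv, hv0⟩ : ∃ v, (ContinuousLinearMap.id 𝕜 X - B ∘L C) v = 0 ∧ v ≠ 0 := by
    by_contra! hcon
    have := h.finrank_ker
    rw [LinearMap.ker_eq_bot'.2 hcon, finrank_bot] at this
    lia
  obtain ⟨x, hx⟩ : ∃ x, x ∉ (ContinuousLinearMap.id 𝕜 X - B ∘L C).range := by
    by_contra! hcon
    have h1 := h.finrank_coker
    have : Subsingleton (X ⧸ (ContinuousLinearMap.id 𝕜 X - B ∘L C).range) :=
      Submodule.Quotient.subsingleton_iff.2 (Submodule.eq_top_iff'.2 hcon)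
    rw [finrank_zero_of_subsingleton] at h1
    lia
  have hCv : C v ≠ 0 := by
    intro h0
    exact hv0 (by simpa [h0] using hv)
  obtain ⟨φ, hφ⟩ := SeparatingDual.exists_eq_one (R := 𝕜) hCv
  refine ⟨B - φ.smulRight x, C, ?_⟩
  convert h.add_smulRight hv (ψ := φ.toLinearMap ∘ₗ C.toLinearMap) hφ hx using 1
  ext w
  simp
  abel

theorem exists_dual_eq_one_of_notMem (N : Submodule 𝕜 Y) [FiniteDimensional 𝕜 N] {y : Y}
    (hy : y ∉ N) : ∃ φ : Y →L[𝕜] 𝕜, (∀ z ∈ N, φ z = 0) ∧ φ y = 1 := by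
  have : IsClosed (N : Set Y) := N.closed_of_finiteDimensional
  have hy' : N.mkQ y ≠ 0 := by simpa using hy
  obtain ⟨φ, hφ⟩ := SeparatingDual.exists_eq_one (R := 𝕜) hy'
  refine ⟨φ ∘L N.mkQL, fun z hz => ?_, hφ⟩
  have hz' : N.mkQ z = 0 := by simpa using hz
  change φ (N.mkQ z) = 0
  rw [hz', map_zero]

/-- Nonzero index forces `C` to have infinite rank, which leaves room for a functional φ ∘ C that
vanishes on the kernel but not identically. -/
theorem Pairable.succ {a b : ℕ} (hab : a ≠ b) (h : Pairable 𝕜 X Y a b) :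
    Pairable 𝕜 X Y (a + 1) (b + 1) := by
  obtain ⟨B, C, h⟩ := h
  have hfin := h.finite_ker
  set U := ContinuousLinearMap.id 𝕜 X - B ∘L C with hU
  -- Otherwise ran C lies in the finite-dimensional C(ker U), and 1 - BC has index 0.
  obtain ⟨z, hz⟩ : ∃ z, C z ∉ U.ker.map C.toLinearMap := by
    by_contra! hcon
    have hle : C.range ≤ U.ker.map C.toLinearMap := by
      rintro _ ⟨z, rfl⟩
      exact hcon z
    have : FiniteDimensional 𝕜 C.range := Submodule.finiteDimensional_of_le hle
    obtain ⟨m, hm⟩ := exists_hasDefect_id_sub (B.toLinearMap ∘ₗ C.range.subtype) C.rangeRestrict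
    have h1 := h.index
    have : LinearMap.id - (B.toLinearMap ∘ₗ C.range.subtype) ∘ₗ C.rangeRestrict =
      U.toLinearMap := rfl
    rw [← this, hm.index] at h1
    lia
  obtain ⟨φ, hφ, hφz⟩ := exists_dual_eq_one_of_notMem _ hz
  refine ⟨B + φ.smulRight (U z), C, ?_⟩
  convert h.sub_smulRight (ψ := φ.toLinearMap ∘ₗ C.toLinearMap)
    (fun w hw => hφ _ ⟨w, hw, rfl⟩) hφz using 1
  ext w
  simp [hU]
  abel

theorem pairable_zero : Pairable 𝕜 X Y 0 0 := by
  refine ⟨0, 0, ?_⟩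
  convert hasDefect_id (k := 𝕜) (M := X)
  ext
  simp

/-- Covers index 0, where `Pairable.succ` is not available. The kernels serve only as complemented
subspaces of equal dimension `a`; identifying them makes BC a projection onto ker U. -/
theorem pairable_self {U : X →L[𝕜] X} {V : Y →L[𝕜] Y} {a b c : ℕ}
    (hU : HasDefect U.toLinearMap a b) (hV : HasDefect V.toLinearMap a c) :
    Pairable 𝕜 X Y a a := by
  have := hU.finite_ker
  have := hV.finite_ker
  let e : U.ker ≃L[𝕜] V.ker :=
    ContinuousLinearEquiv.ofFinrankEq (hU.finrank_ker.trans hV.finrank_ker.symm)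
  obtain ⟨p, hp⟩ := Submodule.ClosedComplemented.of_finiteDimensional U.ker
  obtain ⟨q, hq⟩ := Submodule.ClosedComplemented.of_finiteDimensional V.ker
  refine ⟨U.ker.subtypeL ∘L (e.symm : V.ker →L[𝕜] U.ker) ∘L q,
    V.ker.subtypeL ∘L (e : U.ker →L[𝕜] V.ker) ∘L p, ?_⟩
  have h := hasDefect_id_sub_of_comp_eq_id (i := U.ker.subtype) (p := p.toLinearMap)
    (LinearMap.ext hp)
  rw [hU.finrank_ker] at h
  convert h
  ext
  simp [hq]

theorem Pairable.of_add {n a b : ℕ} (h : Pairable 𝕜 X Y (a + n) (b + n)) : Pairable 𝕜 X Y a b := by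
  induction n with
  | zero => exact h
  | succ n ih => exact ih h.of_succ

/-- Lowering the defects by a finite-rank perturbation. -/
theorem HasDefect.exists_of_add {n a b : ℕ} {T : X →L[𝕜] X}
    (h : HasDefect T.toLinearMap (a + n) (b + n)) :
    ∃ S : X →L[𝕜] X, HasDefect S.toLinearMap a b := by
  -- With Y = X every operator factors: T = 1 - BC for B = 1 and C = 1 - T.
  have hP : Pairable 𝕜 X X (a + n) (b + n) :=
    ⟨.id 𝕜 X, .id 𝕜 X - T, by convert h; ext; simp⟩
  obtain ⟨B, C, hBC⟩ := hP.of_add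
  exact ⟨_, hBC⟩

/-- If some defects of a given index occur for an operator `1 - BC` that factors through `Y`, then
so do all defects of that index that occur both on `X` and on `Y`. -/
theorem Pairable.of_index_eq {a b c d : ℕ} (h : Pairable 𝕜 X Y a b)
    (hk : (a : ℤ) - b = c - d) {U : X →L[𝕜] X} {V : Y →L[𝕜] Y}
    (hU : HasDefect U.toLinearMap c d) (hV : HasDefect V.toLinearMap c d) :
    Pairable 𝕜 X Y c d := by
  rcases eq_or_ne c d with rfl | hcd
  · exact pairable_self hU hV
  have up : ∀ n a b : ℕ, a ≠ b → Pairable 𝕜 X Y a b → Pairable 𝕜 X Y (a + n) (b + n) := by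
    intro n a b hab h
    induction n with
    | zero => exact h
    | succ n ih => exact ih.succ (by lia)
  rcases le_total a c with hac | hac
  · obtain ⟨n, rfl⟩ := Nat.exists_eq_add_of_le hac
    obtain rfl : d = b + n := by lia
    exact up n a b (by lia) h
  · obtain ⟨n, rfl⟩ := Nat.exists_eq_add_of_le hac
    obtain rfl : b = d + n := by lia
    exact of_add h

/-- The indices of `1 - BC`, as `C` varies, are closed under integer multiples. -/
theorem Pairable.exists_index_mul [CompleteSpace Y] {a b : ℕ} (h : Pairable 𝕜 X Y a b) (m : ℤ) :
    ∃ c d, Pairable 𝕜 X Y c d ∧ (c : ℤ) - d = (a - b) * m := by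
  obtain ⟨B, C, h⟩ := h
  suffices hs : ∃ (C' : X →L[𝕜] Y) (c d : ℕ),
      HasDefect (ContinuousLinearMap.id 𝕜 X - B ∘L C').toLinearMap c d ∧
        (c : ℤ) - d = (a - b) * m by
    obtain ⟨C', c, d, h', hcd⟩ := hs
    exact ⟨c, d, ⟨B, C', h'⟩, hcd⟩
  have mul : ∀ C₁ C₂ : X →L[𝕜] Y,
      (ContinuousLinearMap.id 𝕜 X - B ∘L C₁).toLinearMap ∘ₗ
        (ContinuousLinearMap.id 𝕜 X - B ∘L C₂).toLinearMap =
      (ContinuousLinearMap.id 𝕜 X - B ∘L (C₁ + C₂ - C₁ ∘L B ∘L C₂)).toLinearMap := by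
    intro C₁ C₂
    ext
    simp
    abel
  have step : ∀ (C₀ : X →L[𝕜] Y) (i j : ℕ),
      HasDefect (ContinuousLinearMap.id 𝕜 X - B ∘L C₀).toLinearMap i j → ∀ n : ℕ,
      ∃ (C' : X →L[𝕜] Y) (c d : ℕ),
        HasDefect (ContinuousLinearMap.id 𝕜 X - B ∘L C').toLinearMap c d ∧
          (c : ℤ) - d = (i - j) * n := by
    intro C₀ i j h₀ n
    induction n with
    | zero =>
      refine ⟨0, 0, 0, ?_, by simp⟩
      convert hasDefect_id (k := 𝕜) (M := X)
      ext
      simp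
    | succ n ih =>
      obtain ⟨C', c, d, h', hcd⟩ := ih
      obtain ⟨p, q, hpq, hpq'⟩ := h'.comp h₀
      rw [mul] at hpq
      exact ⟨_, p, q, hpq, by push_cast; linear_combination hpq' + hcd⟩
  have hV : HasDefect (ContinuousLinearMap.id 𝕜 Y - C ∘L B).toLinearMap a b :=
    HasDefect.swap (B := B.toLinearMap) (C := C.toLinearMap) h
  -- For negative multiples: modelled on (1 - BC)⁻¹ = 1 + B(1 - CB)⁻¹C, the operator 1 + BWC is a
  -- quasi-inverse of 1 - BC with the same `B`.
  obtain ⟨W, hWV, hVW⟩ := hV.exists_quasiInverse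
  set V := ContinuousLinearMap.id 𝕜 Y - C ∘L B with hVdef
  have h₁ : (ContinuousLinearMap.id 𝕜 X - B ∘L (-(W ∘L C))).toLinearMap ∘ₗ
      (ContinuousLinearMap.id 𝕜 X - B ∘L C).toLinearMap = LinearMap.id - B.toLinearMap ∘ₗ
        (ContinuousLinearMap.id 𝕜 Y - W ∘L V).toLinearMap ∘ₗ C.toLinearMap := by
    ext
    simp [hVdef]
    abel
  have h₂ : (ContinuousLinearMap.id 𝕜 X - B ∘L C).toLinearMap ∘ₗ
      (ContinuousLinearMap.id 𝕜 X - B ∘L (-(W ∘L C))).toLinearMap = LinearMap.id - B.toLinearMap ∘ₗ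
        (ContinuousLinearMap.id 𝕜 Y - V ∘L W).toLinearMap ∘ₗ C.toLinearMap := by
    ext
    simp [hVdef]
    abel
  have fin : ∀ F : Y →L[𝕜] Y, FiniteDimensional 𝕜 F.range →
      ∃ n, HasDefect (LinearMap.id - B.toLinearMap ∘ₗ F.toLinearMap ∘ₗ C.toLinearMap) n n :=
    fun F hF => exists_hasDefect_id_sub (B.toLinearMap ∘ₗ F.range.subtype)
      (F.toLinearMap.rangeRestrict ∘ₗ C.toLinearMap)
  obtain ⟨r, hr⟩ := fin _ hWV
  obtain ⟨s, hs⟩ := fin _ hVW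
  rw [← h₁] at hr
  rw [← h₂] at hs
  obtain ⟨p, q, hpq, hpq'⟩ := h.of_comp_comp hr hs
  obtain ⟨n, rfl | rfl⟩ := m.eq_nat_or_neg
  · exact step _ a b h n
  · obtain ⟨C', c, d, h', hcd⟩ := step _ p q hpq n
    exact ⟨C', c, d, h', by rw [hcd, hpq']; ring⟩

end Pairs
end FredholmPair

/-! ### The index sets as subsets of ℤ -/

namespace FredholmPair

section Indices

open Module

theorem mem_multiples {n : ℕ} {k : ℤ} : k ∈ multiples n ↔ (n : ℤ) ∣ k := Iff.rfl

/-- A subgroup of `ℤ` consists of the multiples of its least positive element. -/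
theorem multiples_sInf (H : AddSubgroup ℤ) :
    multiples (sInf {k : ℕ | 1 ≤ k ∧ (k : ℤ) ∈ H}) = H := by
  set S := {k : ℕ | 1 ≤ k ∧ (k : ℤ) ∈ H} with hS
  ext k
  rw [mem_multiples, SetLike.mem_coe]
  rcases S.eq_empty_or_nonempty with hE | hne
  · rw [hE, Nat.sInf_empty, Nat.cast_zero, zero_dvd_iff]
    refine ⟨by rintro rfl; exact H.zero_mem, fun hk => ?_⟩
    by_contra h0
    have : k.natAbs ∈ S := by
      refine ⟨by lia, ?_⟩
      rcases k.natAbs_eq with h | h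
      · rwa [← h]
      · rw [← neg_mem_iff]
        rwa [h] at hk
    rw [hE] at this
    exact this
  · obtain ⟨h1, hmem⟩ := Nat.sInf_mem hne
    set n := sInf S
    have hmul : ∀ m : ℤ, (n : ℤ) * m ∈ H := fun m => by
      rw [mul_comm, ← smul_eq_mul]
      exact H.zsmul_mem hmem m
    refine ⟨by rintro ⟨m, rfl⟩; exact hmul m, fun hk => ?_⟩
    have hr : k % n ∈ H := by
      rw [Int.emod_def]
      exact H.sub_mem hk (hmul _)
    have hpos := Int.emod_nonneg k (b := n) (by lia)
    have hlt := Int.emod_lt_of_pos k (b := n) (by lia)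
    refine Int.dvd_of_emod_eq_zero ?_
    by_contra h0
    have : (k % n).toNat ∈ S := ⟨by lia, by rwa [Int.toNat_of_nonneg hpos]⟩
    have := Nat.sInf_le this
    lia

variable (𝕜 : Type*) [RCLike 𝕜]
  (X : Type u) [NormedAddCommGroup X] [NormedSpace 𝕜 X] [CompleteSpace X]
  (Y : Type v) [NormedAddCommGroup Y] [NormedSpace 𝕜 Y] [CompleteSpace Y]

variable {X} in
theorem mem_IPhi_iff {k : ℤ} :
    k ∈ IPhi 𝕜 X ↔ ∃ (T : X →L[𝕜] X) (a b : ℕ), HasDefect T.toLinearMap a b ∧ (a : ℤ) - b = k :=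
  exists_congr fun _ => mem_Phi_iff

/-- The indices of the Fredholm operators on `X`. -/
def indexSubgroup : AddSubgroup ℤ where
  carrier := IPhi 𝕜 X
  zero_mem' := (mem_IPhi_iff 𝕜).2 ⟨.id 𝕜 X, 0, 0, hasDefect_id, by simp⟩
  add_mem' := by
    intro k l hk hl
    obtain ⟨T, a, b, hT, rfl⟩ := (mem_IPhi_iff 𝕜).1 hk
    obtain ⟨S, c, d, hS, rfl⟩ := (mem_IPhi_iff 𝕜).1 hl
    obtain ⟨p, q, h, hpq⟩ := hT.comp hS
    exact (mem_IPhi_iff 𝕜).2 ⟨S ∘L T, p, q, h, hpq⟩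
  neg_mem' := by
    intro k hk
    obtain ⟨T, a, b, hT, rfl⟩ := (mem_IPhi_iff 𝕜).1 hk
    obtain ⟨S, hS₁, hS₂⟩ := hT.exists_quasiInverse
    obtain ⟨m, hm⟩ := exists_hasDefect_id_sub_of_finite_range
      (ContinuousLinearMap.id 𝕜 X - S ∘L T).toLinearMap
    obtain ⟨n, hn⟩ := exists_hasDefect_id_sub_of_finite_range
      (ContinuousLinearMap.id 𝕜 X - T ∘L S).toLinearMap
    obtain ⟨p, q, h, hpq⟩ := hT.of_comp_comp (g := S.toLinearMap)
      (by convert hm; ext; simp) (by convert hn; ext; simp)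
    exact (mem_IPhi_iff 𝕜).2 ⟨S, p, q, h, by lia⟩

theorem multiples_eae : multiples (eae 𝕜 X Y) = IPhi 𝕜 X ∩ IPhi 𝕜 Y :=
  multiples_sInf (indexSubgroup 𝕜 X ⊓ indexSubgroup 𝕜 Y)

theorem setOf_EAE_nonempty : {k : ℤ | (EAE 𝕜 X Y k).Nonempty} = IPhi 𝕜 X ∩ IPhi 𝕜 Y := by
  ext k
  constructor
  · rintro ⟨⟨U, V⟩, hU, hV, -⟩
    exact ⟨⟨U, hU⟩, ⟨V, hV⟩⟩
  · rintro ⟨hX, hY⟩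
    obtain ⟨U, a, b, hU, rfl⟩ := (mem_IPhi_iff 𝕜).1 hX
    obtain ⟨V, c, d, hV, hcd⟩ := (mem_IPhi_iff 𝕜).1 hY
    suffices h : ∃ (U' : X →L[𝕜] X) (V' : Y →L[𝕜] Y) (p q : ℕ),
        HasDefect U'.toLinearMap p q ∧ HasDefect V'.toLinearMap p q ∧ (p : ℤ) - q = a - b by
      obtain ⟨U', V', p, q, hU', hV', hpq⟩ := h
      exact ⟨(U', V'), mem_Phi_iff.2 ⟨p, q, hU', hpq⟩, mem_Phi_iff.2 ⟨p, q, hV', hpq⟩,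
        hU'.equivAfterExt hV'⟩
    -- The indices agree but the defects need not; lowering the larger pair makes them equal.
    rcases le_total a c with hac | hac
    · obtain ⟨n, rfl⟩ := Nat.exists_eq_add_of_le hac
      obtain rfl : d = b + n := by lia
      obtain ⟨V', hV'⟩ := hV.exists_of_add
      exact ⟨U, V', a, b, hU, hV', rfl⟩
    · obtain ⟨n, rfl⟩ := Nat.exists_eq_add_of_le hac
      obtain rfl : b = d + n := by lia
      obtain ⟨U', hU'⟩ := hU.exists_of_add
      exact ⟨U', V, c, d, hU', hV, hcd⟩

theorem SC_subset_EAE (k : ℤ) : SC 𝕜 X Y k ⊆ EAE 𝕜 X Y k := by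
  rintro ⟨U, V⟩ ⟨hU, hV, h⟩
  obtain ⟨a, b, hab, -⟩ := mem_Phi_iff.1 hU
  exact ⟨hU, hV, hab.equivAfterExt (h.hasDefect hab).1⟩

variable {𝕜 X Y} in
theorem Pairable.mem_ISC {a b : ℕ} (h : Pairable 𝕜 X Y a b) : (a : ℤ) - b ∈ ISC 𝕜 X Y := by
  obtain ⟨B, C, hBC⟩ := id h
  have hCB : HasDefect (ContinuousLinearMap.id 𝕜 Y - C ∘L B).toLinearMap a b :=
    HasDefect.swap (B := B.toLinearMap) (C := C.toLinearMap) hBC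
  exact ⟨(_, _), mem_Phi_iff.2 ⟨a, b, hBC, rfl⟩, mem_Phi_iff.2 ⟨a, b, hCB, rfl⟩,
    h.schurCoupled hBC hCB⟩

theorem mem_ISC_iff {k : ℤ} :
    k ∈ ISC 𝕜 X Y ↔ ∃ a b : ℕ, Pairable 𝕜 X Y a b ∧ (a : ℤ) - b = k := by
  constructor
  · rintro ⟨⟨U, V⟩, hU, -, h⟩
    obtain ⟨a, b, hab, hk⟩ := mem_Phi_iff.1 hU
    exact ⟨a, b, (h.hasDefect hab).2, hk⟩
  · rintro ⟨a, b, h, rfl⟩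
    exact h.mem_ISC

/-- A single coupled pair of index `k` yields pairable defects, and `Pairable.of_index_eq` moves
them to the defects of any given EAE pair. -/
theorem SC_eq_EAE {k : ℤ} (hk : k ∈ ISC 𝕜 X Y) : SC 𝕜 X Y k = EAE 𝕜 X Y k := by
  refine (SC_subset_EAE 𝕜 X Y k).antisymm ?_
  rintro ⟨U, V⟩ ⟨hU, hV, h⟩
  obtain ⟨a, b, hP, hab⟩ := (mem_ISC_iff 𝕜 X Y).1 hk
  obtain ⟨c, d, hcd, hk'⟩ := mem_Phi_iff.1 hU
  have hV' := h.hasDefect hcd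
  exact ⟨hU, hV, (hP.of_index_eq (hab.trans hk'.symm) hcd hV').schurCoupled hcd hV'⟩

theorem ISC_eq : ISC 𝕜 X Y = {k : ℤ | SC 𝕜 X Y k = EAE 𝕜 X Y k ∧ (EAE 𝕜 X Y k).Nonempty} := by
  ext k
  constructor
  · exact fun hk => ⟨SC_eq_EAE 𝕜 X Y hk, hk.mono (SC_subset_EAE 𝕜 X Y k)⟩
  · rintro ⟨h, hne⟩
    exact show (SC 𝕜 X Y k).Nonempty from h ▸ hne

theorem multiples_sc_subset : multiples (sc 𝕜 X Y) ⊆ ISC 𝕜 X Y := by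
  have h : ((sc 𝕜 X Y : ℕ) : ℤ) ∈ ISC 𝕜 X Y := by
    rcases {k : ℕ | 1 ≤ k ∧ (k : ℤ) ∈ ISC 𝕜 X Y}.eq_empty_or_nonempty with hE | hne
    -- Here `sc` has the default value 0, which is attained by B = C = 0.
    · rw [sc, hE, Nat.sInf_empty]
      exact (mem_ISC_iff 𝕜 X Y).2 ⟨0, 0, pairable_zero, by simp⟩
    · exact (Nat.sInf_mem hne).2
  rintro _ ⟨m, rfl⟩
  obtain ⟨a, b, hP, hab⟩ := (mem_ISC_iff 𝕜 X Y).1 h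
  obtain ⟨c, d, hP', hcd⟩ := hP.exists_index_mul m
  rw [← hab, ← hcd]
  exact hP'.mem_ISC

theorem ISC_subset : ISC 𝕜 X Y ⊆ multiples (eae 𝕜 X Y) := by
  rw [multiples_eae, ← setOf_EAE_nonempty]
  exact fun k hk => hk.mono (SC_subset_EAE 𝕜 X Y k)

end Indices

end FredholmPair

/-! ### Assembling the three assertions -/

theorem proposition1p5 {𝕜 : Type*} [RCLike 𝕜]
    (X : Type u) [NormedAddCommGroup X] [NormedSpace 𝕜 X] [CompleteSpace X]
    (Y : Type v) [NormedAddCommGroup Y] [NormedSpace 𝕜 Y] [CompleteSpace Y] :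
    (∃ n : ℕ, FredholmPair.sc 𝕜 X Y = n * FredholmPair.eae 𝕜 X Y) ∧
    (FredholmPair.multiples (FredholmPair.sc 𝕜 X Y) ⊆ FredholmPair.ISC 𝕜 X Y ∧
      FredholmPair.ISC 𝕜 X Y =
        {k : ℤ | FredholmPair.SC 𝕜 X Y k = FredholmPair.EAE 𝕜 X Y k ∧
          (FredholmPair.EAE 𝕜 X Y k).Nonempty} ∧
      FredholmPair.ISC 𝕜 X Y ⊆ FredholmPair.multiples (FredholmPair.eae 𝕜 X Y) ∧
      FredholmPair.multiples (FredholmPair.eae 𝕜 X Y) =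
        {k : ℤ | (FredholmPair.EAE 𝕜 X Y k).Nonempty} ∧
      {k : ℤ | (FredholmPair.EAE 𝕜 X Y k).Nonempty} =
        FredholmPair.IPhi 𝕜 X ∩ FredholmPair.IPhi 𝕜 Y) ∧
    ((∀ k : ℤ, FredholmPair.SC 𝕜 X Y k = FredholmPair.EAE 𝕜 X Y k) ↔
      FredholmPair.sc 𝕜 X Y = FredholmPair.eae 𝕜 X Y) := by
  have hsub := FredholmPair.multiples_sc_subset 𝕜 X Y
  have hsub' := FredholmPair.ISC_subset 𝕜 X Y
  have hEAE := FredholmPair.setOf_EAE_nonempty 𝕜 X Y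
  have heae := (FredholmPair.multiples_eae 𝕜 X Y).trans hEAE.symm
  refine ⟨?_, ⟨hsub, FredholmPair.ISC_eq 𝕜 X Y, hsub', heae, hEAE⟩, fun h => ?_, fun h k => ?_⟩
  -- `sc` is a multiple of itself, so the chain of inclusions places it among the multiples of
  -- `eae`.
  · have hdvd := FredholmPair.mem_multiples.1 (hsub' (hsub ⟨1, (mul_one _).symm⟩))
    obtain ⟨n, hn⟩ := Int.natCast_dvd_natCast.1 hdvd
    exact ⟨n, by rw [hn, mul_comm]⟩
  · have hISC : FredholmPair.ISC 𝕜 X Y = FredholmPair.IPhi 𝕜 X ∩ FredholmPair.IPhi 𝕜 Y := by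
      rw [← hEAE]
      simp only [FredholmPair.ISC, h]
    rw [FredholmPair.sc, FredholmPair.eae, hISC]
  · by_cases hk : k ∈ FredholmPair.ISC 𝕜 X Y
    · exact FredholmPair.SC_eq_EAE 𝕜 X Y hk
    -- Off the SC indices both sets are empty: an EAE pair would make `k` a multiple of eae = sc,
    -- hence an SC index.
    · have hk' : ¬(FredholmPair.EAE 𝕜 X Y k).Nonempty := fun hne => by
        have : k ∈ FredholmPair.multiples (FredholmPair.eae 𝕜 X Y) := heae ▸ hne
        exact hk (hsub (h ▸ this))
      rw [Set.not_nonempty_iff_eq_empty.1 hk', Set.not_nonempty_iff_eq_empty.1 hk]
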